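/- Let $R$ be an algebraically closed field of characteristic $p\ge 0$, let $n,m\ge 1$, and let $\sigma\in\Sigma_n$ and $\tau\in\Sigma_m$ be permutations of cycle types $(\lambda_1,\dots,\lambda_s)$ and $(\mu_1,\dots,\mu_t)$, respectively (fixed points are counted as cycles of length $1$, so $\sum_i\lambda_i=n$ and $\sum_j\mu_j=m$). Let $S_n(\sigma,R)$ denote the $R$-algebra of all $n\times n$ matrices $(a_{ij})$ over $R$ with $a_{ij}=a_{\sigma(i),\sigma(j)}$ for all $1\le i,j\le n$, and define $S_m(\tau,R)$ likewise. Assume that $p\nmid\lambda_i$ for all $1\le i\le s$ and $p\nmid\mu_j$ for all $1\le j\le t$, that $\gcd(\lambda_i,\lambda_j)=1$ for all $1\le i\ne j\le s$, and that $\gcd(\mu_i,\mu_j)=1$ for all $1\le i\ne j\le t$. Then: (1) $S_n(\sigma,R)$ and $S_m(\tau,R)$ are isomorphic as $R$-algebras if and only if $n=m$ and $s=t$. (2) $S_n(\sigma,R)$ and $S_m(\tau,R)$ are Morita equivalent as $R$-algebras (that is, their module categories are equivalent as $R$-linear categories) if and only if $n-s=m-t$. -/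

import Mathlib

/-- The `σ`-invariant matrix algebra `S_n(σ, R)`: all `n × n` matrices `a` over `R` with
`a i j = a (σ i) (σ j)` for all `i, j`, as an `R`-subalgebra of the full matrix algebra. -/
def invariantMatrixAlgebra {n : ℕ} (σ : Equiv.Perm (Fin n)) (R : Type*) [CommRing R] :
    Subalgebra R (Matrix (Fin n) (Fin n) R) where
  carrier := {a | ∀ i j : Fin n, a i j = a (σ i) (σ j)}
  mul_mem' := by
    intro a b ha hb i j
    rw [Matrix.mul_apply, Matrix.mul_apply, ← Equiv.sum_comp σ (fun k => a (σ i) k * b k (σ j))]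
    exact Finset.sum_congr rfl fun k _ => by rw [ha i k, hb k j]
  add_mem' := by
    intro a b ha hb i j
    rw [Matrix.add_apply, Matrix.add_apply, ha i j, hb i j]
  algebraMap_mem' := by
    intro r i j
    simp [Matrix.algebraMap_matrix_apply]

/-- The permutation `σ` of `n` points has cycle type `(lam 0, …, lam (s - 1))`: the lengths of
its disjoint cycles, with each fixed point counted as a cycle of length one, are the entries of
`lam`, with multiplicity. The order of the entries is immaterial. -/
def HasFullCycleType {n s : ℕ} (σ : Equiv.Perm (Fin n)) (lam : Fin s → ℕ) : Prop :=
  σ.partition.parts = Finset.univ.val.map lam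

/-! Let `T` be the operator `f ↦ f ∘ σ` on `R^n`; the invariant matrices are its centralizer. Since
`p` divides no `λ_i`, `T` is killed by the separable polynomial `X^N - 1` with `N = ∏ λ_i`, hence is
diagonalizable. Its fixed vectors are the functions constant on cycles, of dimension `s`. An
eigenvector for `μ ≠ 1` lives on a single cycle by coprimality, so that eigenspace has dimension at
most `1`. Hence the algebra is `M_s(R) × R^(n-s)` (`nonempty_invariantMatrixAlgebra_algEquiv`).

This is Morita equivalent to the commutative algebra `R × R^(n-s)`, whose dimension is a Morita
invariant by `finrank_le_of_isMoritaEquivalent`; this gives (2). An isomorphism is a Morita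
equivalence, so it fixes `n - s`, and the dimension `s² + (n - s)` then fixes `s`; this gives (1).
-/

open CategoryTheory Module

universe u

/-! ### Modules over a product of rings, and Morita equivalence of products. -/

section Corner

variable {A B : Type u} [Ring A] [Ring B]

/-- The `A`-module `φ(1) X` attached to a `B`-module `X` and a non-unital ring homomorphism
`φ : A → B`. -/
def cornerSubgroup (φ : A →ₙ+* B) (X : Type u) [AddCommGroup X] [Module B X] : AddSubgroup X where
  carrier := {x | φ 1 • x = x}
  zero_mem' := smul_zero _
  add_mem' {x y} hx hy := by
    change φ 1 • (x + y) = x + y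
    rw [smul_add, hx, hy]
  neg_mem' {x} hx := by
    change φ 1 • (-x) = -x
    rw [smul_neg, hx]

instance cornerModule (φ : A →ₙ+* B) (X : Type u) [AddCommGroup X] [Module B X] :
    Module A (cornerSubgroup φ X) where
  smul a x := ⟨φ a • (x : X), by
    change φ 1 • φ a • (x : X) = φ a • (x : X)
    rw [← mul_smul, ← map_mul, one_mul]⟩
  one_smul x := Subtype.ext x.2
  mul_smul a b x := Subtype.ext (by
    change φ (a * b) • (x : X) = φ a • φ b • (x : X)
    rw [map_mul, mul_smul])
  smul_zero a := Subtype.ext (smul_zero (φ a))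
  smul_add a x y := Subtype.ext (smul_add (φ a) (x : X) y)
  add_smul a b x := Subtype.ext (by
    change φ (a + b) • (x : X) = φ a • (x : X) + φ b • (x : X)
    rw [map_add, add_smul])
  zero_smul x := Subtype.ext (by
    change φ 0 • (x : X) = 0
    rw [map_zero, zero_smul])

end Corner

section Prod

variable (A C : Type u) [Ring A] [Ring C]

/-- The inclusion of the first factor of a product of rings. -/
def prodInl : A →ₙ+* A × C where
  toFun a := (a, 0)
  map_mul' _ _ := by simp
  map_zero' := rfl
  map_add' _ _ := by simp

/-- The inclusion of the second factor of a product of rings. -/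
def prodInr : C →ₙ+* A × C where
  toFun c := (0, c)
  map_mul' _ _ := by simp
  map_zero' := rfl
  map_add' _ _ := by simp

/-- The componentwise module structure of a product of modules over a product of rings. -/
abbrev prodModule (M N : Type u) [AddCommGroup M] [AddCommGroup N] [Module A M] [Module C N] :
    Module (A × C) (M × N) where
  smul r x := (r.1 • x.1, r.2 • x.2)
  one_smul x := Prod.ext (one_smul A x.1) (one_smul C x.2)
  mul_smul r s x := Prod.ext (mul_smul r.1 s.1 x.1) (mul_smul r.2 s.2 x.2)
  smul_zero r := Prod.ext (smul_zero r.1) (smul_zero r.2)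
  smul_add r x y := Prod.ext (smul_add r.1 x.1 y.1) (smul_add r.2 x.2 y.2)
  add_smul r s x := Prod.ext (add_smul r.1 s.1 x.1) (add_smul r.2 s.2 x.2)
  zero_smul x := Prod.ext (zero_smul A x.1) (zero_smul C x.2)

/-- The type of pairs, with its componentwise module structure over the product of rings. -/
def PairModule (M : ModuleCat.{u} A) (N : ModuleCat.{u} C) : Type u := M × N

instance (M : ModuleCat.{u} A) (N : ModuleCat.{u} C) : AddCommGroup (PairModule A C M N) :=
  inferInstanceAs (AddCommGroup (M × N))

instance (M : ModuleCat.{u} A) (N : ModuleCat.{u} C) : Module (A × C) (PairModule A C M N) :=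
  prodModule A C M N

/-- The functor sending a pair of modules to its product, a module over the product of rings. -/
def pairFunctor : ModuleCat.{u} A × ModuleCat.{u} C ⥤ ModuleCat.{u} (A × C) where
  obj P := ModuleCat.of (A × C) (PairModule A C P.1 P.2)
  map {_ Q} f := ModuleCat.ofHom
    { toFun := fun x => ((f.1.hom x.1, f.2.hom x.2) : Q.1 × Q.2)
      map_add' := fun x y => Prod.ext (map_add f.1.hom x.1 y.1) (map_add f.2.hom x.2 y.2)
      map_smul' := fun r x => Prod.ext (map_smul f.1.hom r.1 x.1) (map_smul f.2.hom r.2 x.2) }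
  map_id _ := rfl
  map_comp _ _ := rfl

instance : (pairFunctor A C).Faithful where
  map_injective {_ _ f g} h := by
    have key x y : ((f.1.hom x, f.2.hom y) : _ × _) = (g.1.hom x, g.2.hom y) :=
      congrArg (fun k => k.hom ((x, y) : _ × _)) h
    refine Prod.ext ?_ ?_
    · ext x
      exact congrArg Prod.fst (key x 0)
    · ext y
      exact congrArg Prod.snd (key 0 y)

/-- Linearity over the idempotents `(1, 0)` and `(0, 1)` kills the off-diagonal components of a map.
-/
instance : (pairFunctor A C).Full where
  map_surjective {P Q} f := by
    let F : PairModule A C P.1 P.2 →ₗ[A × C] PairModule A C Q.1 Q.2 := f.hom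
    let i₁ (x : P.1) : PairModule A C P.1 P.2 := ((x, 0) : P.1 × P.2)
    let i₂ (y : P.2) : PairModule A C P.1 P.2 := ((0, y) : P.1 × P.2)
    have hi₁ (x y : P.1) : i₁ (x + y) = i₁ x + i₁ y := Prod.ext rfl (add_zero (0 : P.2)).symm
    have hi₂ (x y : P.2) : i₂ (x + y) = i₂ x + i₂ y := Prod.ext (add_zero (0 : P.1)).symm rfl
    have hs₁ (a : A) (x : P.1) : i₁ (a • x) = ((a, 0) : A × C) • i₁ x :=
      Prod.ext rfl (zero_smul C (0 : P.2)).symm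
    have hs₂ (c : C) (y : P.2) : i₂ (c • y) = ((0, c) : A × C) • i₂ y :=
      Prod.ext (zero_smul A (0 : P.1)).symm rfl
    have h₁ (x : P.1) : (F (i₁ x)).2 = 0 := by
      have h : F (i₁ x) = ((1, 0) : A × C) • F (i₁ x) := by
        rw [← map_smul, ← hs₁, one_smul]
      rw [h]
      exact zero_smul C _
    have h₂ (y : P.2) : (F (i₂ y)).1 = 0 := by
      have h : F (i₂ y) = ((0, 1) : A × C) • F (i₂ y) := by
        rw [← map_smul, ← hs₂, one_smul]
      rw [h]
      exact zero_smul A _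
    let g₁ : P.1 →ₗ[A] Q.1 :=
      { toFun := fun x => (F (i₁ x)).1
        map_add' := fun x y => by rw [hi₁, map_add]; rfl
        map_smul' := fun a x => by rw [hs₁, map_smul]; rfl }
    let g₂ : P.2 →ₗ[C] Q.2 :=
      { toFun := fun x => (F (i₂ x)).2
        map_add' := fun x y => by rw [hi₂, map_add]; rfl
        map_smul' := fun a x => by rw [hs₂, map_smul]; rfl }
    refine ⟨(ModuleCat.ofHom g₁, ModuleCat.ofHom g₂), ?_⟩
    refine ModuleCat.hom_ext (LinearMap.ext fun x => ?_)
    have hx : x = i₁ x.1 + i₂ x.2 := Prod.ext (add_zero x.1).symm (zero_add x.2).symm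
    have hF : F x = F (i₁ x.1) + F (i₂ x.2) := by rw [← map_add, ← hx]
    change ((F (i₁ x.1)).1, (F (i₂ x.2)).2) = F x
    rw [hF]
    refine Prod.ext ?_ ?_
    · exact ((congrArg ((F (i₁ x.1)).1 + ·) (h₂ x.2)).trans (add_zero _)).symm
    · exact ((congrArg (· + (F (i₂ x.2)).2) (h₁ x.1)).trans (zero_add _)).symm

/-- Every module `X` is the sum of its corners `(1, 0) X` and `(0, 1) X`. -/
instance : (pairFunctor A C).EssSurj where
  mem_essImage X := by
    refine ⟨(ModuleCat.of A (cornerSubgroup (prodInl A C) X),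
      ModuleCat.of C (cornerSubgroup (prodInr A C) X)), ⟨LinearEquiv.toModuleIso ?_⟩⟩
    have h₁ (x : cornerSubgroup (prodInl A C) X) : ((1, 0) : A × C) • (x : X) = x := x.2
    have h₂ (x : cornerSubgroup (prodInr A C) X) : ((0, 1) : A × C) • (x : X) = x := x.2
    have hz : ((0, 1) : A × C) * (1, 0) = 0 := by ext <;> simp
    have hz' : ((1, 0) : A × C) * (0, 1) = 0 := by ext <;> simp
    have h₁' (x : cornerSubgroup (prodInl A C) X) : ((0, 1) : A × C) • (x : X) = 0 := by
      rw [← h₁, ← mul_smul, hz, zero_smul]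
    have h₂' (x : cornerSubgroup (prodInr A C) X) : ((1, 0) : A × C) • (x : X) = 0 := by
      rw [← h₂, ← mul_smul, hz', zero_smul]
    refine
      { toFun := fun x => (x.1 : X) + (x.2 : X)
        invFun := fun x => (⟨((1, 0) : A × C) • x, ?_⟩, ⟨((0, 1) : A × C) • x, ?_⟩)
        map_add' := fun x y => ?_
        map_smul' := fun r x => ?_
        left_inv := fun x => ?_
        right_inv := fun x => ?_ }
    · exact add_add_add_comm (x.1 : X) y.1 x.2 y.2
    · change ((r.1, 0) : A × C) • (x.1 : X) + ((0, r.2) : A × C) • (x.2 : X) = r • (x.1 + x.2 : X)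
      conv_lhs => rw [← h₁ x.1, ← h₂ x.2]
      conv_rhs => rw [← h₁ x.1, ← h₂ x.2]
      simp [smul_add, ← mul_smul]
      simp [Prod.mul_def]
    · change ((1, 0) : A × C) • ((1, 0) : A × C) • x = ((1, 0) : A × C) • x
      rw [← mul_smul]; simp
    · change ((0, 1) : A × C) • ((0, 1) : A × C) • x = ((0, 1) : A × C) • x
      rw [← mul_smul]; simp
    · refine Prod.ext (Subtype.ext ?_) (Subtype.ext ?_)
      · change ((1, 0) : A × C) • ((x.1 : X) + (x.2 : X)) = x.1
        rw [smul_add, h₁, h₂', add_zero]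
      · change ((0, 1) : A × C) • ((x.1 : X) + (x.2 : X)) = x.2
        rw [smul_add, h₂, h₁', zero_add]
    · change ((1, 0) : A × C) • (x : X) + ((0, 1) : A × C) • x = x
      rw [← add_smul, show ((1, 0) : A × C) + (0, 1) = 1 by ext <;> simp, one_smul]

instance : (pairFunctor A C).IsEquivalence where

open scoped ModuleCat.Algebra

variable (R : Type u) [CommRing R] [Algebra R A] [Algebra R C]

theorem pairFunctor_map_smul {P Q : ModuleCat.{u} A × ModuleCat.{u} C} (r : R) (f : P ⟶ Q) :
    (pairFunctor A C).map ((r • f.1, r • f.2) : P ⟶ Q) = r • (pairFunctor A C).map f := by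
  refine ModuleCat.hom_ext (LinearMap.ext fun x => ?_)
  rfl

/-- Faithfulness transfers linearity to the inverse functor, as an `R`-linear Morita equivalence
requires. -/
theorem pairFunctor_inv_map_smul {X Y : ModuleCat.{u} (A × C)} (r : R) (f : X ⟶ Y) :
    (pairFunctor A C).inv.map (r • f) =
      (r • ((pairFunctor A C).inv.map f).1, r • ((pairFunctor A C).inv.map f).2) := by
  apply (pairFunctor A C).map_injective
  rw [pairFunctor_map_smul, Functor.fun_inv_map, Functor.fun_inv_map, Linear.smul_comp,
    Linear.comp_smul]
  rfl

variable {R A C}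

/-- Morita equivalence is preserved by taking the product with a fixed algebra. -/
theorem IsMoritaEquivalent.prod_right {A' : Type u} [Ring A'] [Algebra R A']
    (h : IsMoritaEquivalent R A A') (C : Type u) [Ring C] [Algebra R C] :
    IsMoritaEquivalent R (A × C) (A' × C) := by
  obtain ⟨⟨e⟩⟩ := h
  let E : ModuleCat.{u} A ≌ ModuleCat.{u} A' := e.eqv
  have : E.functor.Linear R := e.linear
  refine ⟨⟨⟨(pairFunctor A C).asEquivalence.symm.trans
    ((E.prod CategoryTheory.Equivalence.refl).trans (pairFunctor A' C).asEquivalence), ?_⟩⟩⟩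
  refine ⟨fun f r => ?_⟩
  change (pairFunctor A' C).map ((E.prod CategoryTheory.Equivalence.refl).functor.map ((pairFunctor A C).inv.map (r • f))) = r • (pairFunctor A' C).map
      ((E.prod CategoryTheory.Equivalence.refl).functor.map ((pairFunctor A C).inv.map f))
  rw [pairFunctor_inv_map_smul, ← pairFunctor_map_smul]
  congr 1
  exact Prod.ext (E.functor.map_smul _ _) rfl

end Prod

/-! ### Dimension as a Morita invariant of commutative algebras. -/

section Dimension

open scoped ModuleCat.Algebra

variable {R B B' : Type u} [Field R] [CommRing B] [Ring B'] [Algebra R B] [Algebra R B']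

/-- An endomorphism is determined by the image of a generator. -/
theorem exists_injective_end_of_linearEquiv (Y : ModuleCat.{u} B') (e : Y ≃ₗ[B'] B') :
    ∃ ψ : (Y ⟶ Y) →ₗ[R] B', Function.Injective ψ := by
  refine ⟨
    { toFun := fun f => e (f.hom (e.symm 1))
      map_add' := fun f g => map_add e _ _
      map_smul' := fun r f => ?_ }, fun f g h => ?_⟩
  · change e (algebraMap R B' r • f.hom (e.symm 1)) = r • e (f.hom (e.symm 1))
    rw [map_smul, algebraMap_smul]
  · have h1 : f.hom (e.symm 1) = g.hom (e.symm 1) := e.injective h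
    ext y
    have hy : y = e y • e.symm 1 := by
      rw [← map_smul, smul_eq_mul, mul_one, e.symm_apply_apply]
    rw [hy, map_smul, map_smul, h1]

/-- With `F` the inverse equivalence, commutativity of `B` lets it act on `F(B')` by endomorphisms,
faithfully because `B'` generates. So `B ↪ End(F(B')) ≅ End(B') ↪ B'`, linearly over `R`. -/
theorem finrank_le_of_isMoritaEquivalent [Module.Finite R B']
    (h : IsMoritaEquivalent R B B') : Module.finrank R B ≤ Module.finrank R B' := by
  obtain ⟨⟨e⟩⟩ := h
  let E : ModuleCat.{u} B ≌ ModuleCat.{u} B' := e.eqv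
  have : E.functor.Linear R := e.linear
  obtain ⟨Y, ⟨ε⟩⟩ : ∃ Y : ModuleCat.{u} B', Nonempty (Y ≃ₗ[B'] B') :=
    ⟨ModuleCat.of B' B', ⟨LinearEquiv.refl _ _⟩⟩
  obtain ⟨ψ, hψ⟩ := exists_injective_end_of_linearEquiv (R := R) Y ε
  let φ : B →ₗ[R] (E.inverse.obj Y ⟶ E.inverse.obj Y) :=
    { toFun := fun b => b • 𝟙 _
      map_add' := fun a b => add_smul a b _
      map_smul' := fun r b => by
        ext x
        change (r • b) • x = (algebraMap R B r) • b • x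
        rw [Algebra.smul_def, mul_smul] }
  let χ : (Y ⟶ Y) ≃ₗ[R] (E.inverse.obj Y ⟶ E.inverse.obj Y) :=
    LinearEquiv.ofBijective (E.inverse.mapLinearMap R)
      ⟨E.inverse.map_injective, E.inverse.map_surjective⟩
  have hφ : Function.Injective φ := by
    rw [← LinearMap.ker_eq_bot, LinearMap.ker_eq_bot']
    intro b hb
    have hb' : b • 𝟙 (E.inverse.obj Y) = 0 := hb
    -- Multiplication by `b` is natural, and every element of `Z` is hit by a map from `Y`, so
    -- vanishing at `Y` spreads to all `Z`.
    have key (Z : ModuleCat.{u} B') : b • 𝟙 (E.inverse.obj Z) = 0 := by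
      obtain ⟨k, hk⟩ := E.inverse.map_surjective (b • 𝟙 (E.inverse.obj Z))
      have hk0 : k = 0 := by
        ext z
        let f : Y ⟶ Z := ModuleCat.ofHom (LinearMap.toSpanSingleton B' Z z ∘ₗ ε.toLinearMap)
        have h : f ≫ k = 0 := by
          apply E.inverse.map_injective
          rw [E.inverse.map_comp, hk, E.inverse.map_zero, Linear.comp_smul, Category.comp_id,
            ← Category.id_comp (E.inverse.map f), ← Linear.smul_comp, hb', Limits.zero_comp]
        have h1 := congrArg (fun g => g.hom (ε.symm 1)) h
        change k.hom (ε (ε.symm 1) • z) = 0 at h1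
        rw [ε.apply_symm_apply, one_smul] at h1
        exact h1
      rw [← hk, hk0, E.inverse.map_zero]
    let X : ModuleCat.{u} B := ModuleCat.of B B
    have hX : b • 𝟙 X = 0 := by
      have h := key (E.functor.obj X)
      calc b • 𝟙 X = E.unit.app X ≫ (b • 𝟙 _) ≫ E.unitInv.app X := by
            rw [Linear.smul_comp, Linear.comp_smul, Category.id_comp]; simp; rfl
        _ = 0 := by
            have h' : b • 𝟙 ((E.functor ⋙ E.inverse).obj X) = 0 := h
            rw [h', Limits.zero_comp, Limits.comp_zero]
    have h1 := congrArg (fun g => g.hom (1 : B)) hX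
    change b • (1 : B) = 0 at h1
    simpa using h1
  refine LinearMap.finrank_le_finrank_of_injective (f := ψ ∘ₗ χ.symm.toLinearMap ∘ₗ φ) ?_
  exact hψ.comp (χ.symm.injective.comp hφ)

end Dimension

/-! ### Labelling the cycles of a permutation. -/

/-- Equal multisets of values have fibres of equal size; bijections of fibres glue. -/
theorem exists_equiv_of_map_univ_eq {α β γ : Type*} [Fintype α] [Fintype β] [DecidableEq γ]
    (f : α → γ) (g : β → γ)
    (h : (Finset.univ : Finset α).val.map f = (Finset.univ : Finset β).val.map g) :
    ∃ e : α ≃ β, ∀ a, g (e a) = f a := by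
  have hc (c : γ) : Nonempty ({a // f a = c} ≃ {b // g b = c}) := by
    refine ⟨Fintype.equivOfCardEq ?_⟩
    have h1 := congrArg (Multiset.count c) h
    rw [Multiset.count_map, Multiset.count_map] at h1
    rw [Fintype.card_subtype, Fintype.card_subtype]
    simp only [eq_comm (a := c)] at h1
    exact h1
  exact ⟨Equiv.ofFiberEquiv fun c => (hc c).some, fun a => Equiv.ofFiberEquiv_map _ a⟩

/-- A permutation of full cycle type `lam` admits a labelling of its cycles by the indices of
`lam`, compatible with the lengths. -/
theorem HasFullCycleType.exists_labelling {n s : ℕ} {σ : Equiv.Perm (Fin n)} {lam : Fin s → ℕ}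
    (h : HasFullCycleType σ lam) :
    ∃ c : Fin n → Fin s, Function.Surjective c ∧ (∀ x y, c x = c y ↔ σ.SameCycle x y) ∧
      ∀ x, (σ ^ lam (c x)) x = x := by
  classical
  -- `cycleFactorsFinset` holds only the nontrivial cycles; the second summand adds the fixed
  -- points.
  let K := {τ // τ ∈ σ.cycleFactorsFinset} ⊕ {x // x ∈ σ.supportᶜ}
  let size : K → ℕ := Sum.elim (fun τ => τ.1.support.card) (fun _ => 1)
  let κ : Fin n → K := fun x =>
    if hx : x ∈ σ.support then
      Sum.inl ⟨σ.cycleOf x, Equiv.Perm.cycleOf_mem_cycleFactorsFinset_iff.2 hx⟩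
    else Sum.inr ⟨x, Finset.mem_compl.2 hx⟩
  have hsize : (Finset.univ : Finset K).val.map size = σ.partition.parts := by
    rw [Equiv.Perm.parts_partition, Equiv.Perm.cycleType_def, ← Finset.card_compl,
      ← Finset.univ_disjSum_univ, Finset.val_disjSum, Multiset.disjSum, Multiset.map_add,
      Multiset.map_map, Multiset.map_map]
    congr 1
    · exact (Multiset.map_congr rfl fun x _ => rfl).trans
        (Multiset.attach_map_val' σ.cycleFactorsFinset.val (fun τ => τ.support.card))
    · refine (Multiset.map_const' _ _).trans ?_
      congr 1
      rw [Finset.card_val, Finset.card_univ, Fintype.card_coe]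
  obtain ⟨e, he⟩ := exists_equiv_of_map_univ_eq size lam (hsize.trans h)
  refine ⟨e ∘ κ, e.surjective.comp ?_, fun x y => ?_, fun x => ?_⟩
  · rintro (⟨τ, hτ⟩ | ⟨x, hx⟩)
    · obtain ⟨x, hx⟩ := (Equiv.Perm.mem_cycleFactorsFinset_iff.1 hτ).1.nonempty_support
      have h1 := Equiv.Perm.cycle_is_cycleOf hx hτ
      have h2 : x ∈ σ.support := by
        rw [← Equiv.Perm.cycleOf_mem_cycleFactorsFinset_iff, ← h1]
        exact hτ
      refine ⟨x, ?_⟩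
      simp only [κ, dif_pos h2]
      congr 2
      exact h1.symm
    · refine ⟨x, ?_⟩
      simp only [κ, dif_neg (Finset.mem_compl.1 hx)]
  · rw [Function.comp_apply, Function.comp_apply, e.apply_eq_iff_eq]
    by_cases hx : x ∈ σ.support <;> by_cases hy : y ∈ σ.support
    · simp only [κ, dif_pos hx, dif_pos hy]
      rw [Sum.inl.injEq, Subtype.mk.injEq]
      exact (Equiv.Perm.sameCycle_iff_cycleOf_eq_of_mem_support hx hy).symm
    · simp only [κ, dif_pos hx, dif_neg hy, reduceCtorEq, false_iff]
      intro hxy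
      exact hy (Equiv.Perm.mem_support.2
        (mt hxy.apply_eq_self_iff.2 (Equiv.Perm.mem_support.1 hx)))
    · simp only [κ, dif_neg hx, dif_pos hy, reduceCtorEq, false_iff]
      intro hxy
      exact hx (Equiv.Perm.mem_support.2
        (mt hxy.apply_eq_self_iff.1 (Equiv.Perm.mem_support.1 hy)))
    · simp only [κ, dif_neg hx, dif_neg hy]
      rw [Sum.inr.injEq, Subtype.mk.injEq]
      refine ⟨fun hxy => hxy ▸ Equiv.Perm.SameCycle.refl _ _, fun hxy => ?_⟩
      obtain ⟨i, hi⟩ := hxy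
      rw [← hi, Equiv.Perm.zpow_apply_eq_self_of_apply_eq_self (Equiv.Perm.notMem_support.1 hx)]
  · rw [Function.comp_apply, he]
    by_cases hx : x ∈ σ.support
    · simp only [κ, dif_pos hx, size, Sum.elim_inl]
      rw [← Equiv.Perm.pow_mod_card_support_cycleOf_self_apply, Nat.mod_self, pow_zero]
      rfl
    · simp only [κ, dif_neg hx, size, Sum.elim_inr, pow_one]
      exact Equiv.Perm.notMem_support.1 hx

/-! ### Eigenspaces of the permutation operator. -/

section Eigenspaces

variable {R : Type*} [Field R] {n s : ℕ} {σ : Equiv.Perm (Fin n)} {lam : Fin s → ℕ}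
  {c : Fin n → Fin s}

theorem mem_eigenspace_funLeft {μ : R} {f : Fin n → R} :
    f ∈ End.eigenspace (LinearMap.funLeft R R σ) μ ↔ ∀ x, f (σ x) = μ * f x := by
  rw [End.mem_eigenspace_iff]
  exact funext_iff

theorem apply_pow_of_mem_eigenspace {μ : R} {f : Fin n → R} (hf : ∀ x, f (σ x) = μ * f x)
    (k : ℕ) (x : Fin n) : f ((σ ^ k) x) = μ ^ k * f x := by
  induction k with
  | zero => simp
  | succ k ih => rw [pow_succ', Equiv.Perm.mul_apply, hf, ih, pow_succ', mul_assoc]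

/-- Fixed vectors are exactly the functions that factor through the cycle labelling `c`. -/
theorem finrank_eigenspace_one (hc : Function.Surjective c)
    (hσ : ∀ x y, c x = c y ↔ σ.SameCycle x y) :
    finrank R (End.eigenspace (LinearMap.funLeft R R σ) 1) = s := by
  have hmem (g : Fin s → R) :
      LinearMap.funLeft R R c g ∈ End.eigenspace (LinearMap.funLeft R R σ) 1 := by
    rw [mem_eigenspace_funLeft]
    intro x
    rw [one_mul, LinearMap.funLeft_apply, LinearMap.funLeft_apply, (hσ (σ x) x).2]
    exact Equiv.Perm.sameCycle_apply_left.2 (Equiv.Perm.SameCycle.refl _ _)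
  let φ := (LinearMap.funLeft R R c).codRestrict _ hmem
  have hφ : Function.Bijective φ := by
    refine ⟨fun f g hfg => ?_, fun f => ?_⟩
    · exact LinearMap.funLeft_injective_of_surjective R R c hc (congrArg Subtype.val hfg)
    · have hf := mem_eigenspace_funLeft.1 f.2
      refine ⟨fun i => f.1 (Function.surjInv hc i), Subtype.ext (funext fun x => ?_)⟩
      change f.1 (Function.surjInv hc (c x)) = f.1 x
      obtain ⟨k, -, hk⟩ := ((hσ _ _).1 (Function.surjInv_eq hc (c x))).exists_pow_eq'
      have h1 := apply_pow_of_mem_eigenspace hf k (Function.surjInv hc (c x))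
      rw [hk, one_pow, one_mul] at h1
      exact h1.symm
  rw [← (LinearEquiv.ofBijective φ hφ).finrank_eq, finrank_fin_fun]

/-- Going once round a cycle where an eigenvector is nonzero gives `μ ^ λ_i = 1`. For `μ ≠ 1`
coprimality allows only one such cycle, and there one value determines the eigenvector. -/
theorem finrank_eigenspace_le_one (hσ : ∀ x y, c x = c y ↔ σ.SameCycle x y)
    (hlam : ∀ x, (σ ^ lam (c x)) x = x)
    (hcop : Pairwise fun i j => Nat.Coprime (lam i) (lam j)) {μ : R} (hμ : μ ≠ 1) :
    finrank R (End.eigenspace (LinearMap.funLeft R R σ) μ) ≤ 1 := by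
  have hpow {f : Fin n → R} (hf : ∀ x, f (σ x) = μ * f x) {x : Fin n} (hx : f x ≠ 0) :
      μ ^ lam (c x) = 1 := by
    have h := apply_pow_of_mem_eigenspace hf (lam (c x)) x
    rw [hlam] at h
    exact (mul_eq_right₀ hx).1 h.symm
  by_cases h0 : ∃ f : End.eigenspace (LinearMap.funLeft R R σ) μ, f ≠ 0
  · obtain ⟨f, hf0⟩ := h0
    obtain ⟨x, hx⟩ : ∃ x, f.1 x ≠ 0 := by
      by_contra! h
      exact hf0 (Subtype.ext (funext h))
    have hf := mem_eigenspace_funLeft.1 f.2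
    refine finrank_le_one f fun g => ⟨g.1 x / f.1 x, ?_⟩
    -- The scalar makes `d` vanish at `x`, hence on the whole cycle of `x`.
    set d := g - (g.1 x / f.1 x) • f with hd
    have hdx : d.1 x = 0 := by
      change g.1 x - g.1 x / f.1 x * f.1 x = 0
      rw [div_mul_cancel₀ _ hx, sub_self]
    have hd' := mem_eigenspace_funLeft.1 d.2
    have hd0 : d = 0 := by
      refine Subtype.ext (funext fun y => ?_)
      by_contra hy
      have hxy : c x = c y := by
        by_contra hne
        have h1 := Nat.eq_one_of_dvd_coprimes (hcop hne) (orderOf_dvd_of_pow_eq_one (hpow hf hx))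
          (orderOf_dvd_of_pow_eq_one (hpow hd' hy))
        exact hμ (orderOf_eq_one_iff.1 h1)
      obtain ⟨k, -, hk⟩ := ((hσ _ _).1 hxy).exists_pow_eq'
      apply hy
      rw [← hk, apply_pow_of_mem_eigenspace hd', hdx, mul_zero]
      rfl
    exact (sub_eq_zero.1 hd0).symm
  · push Not at h0
    exact finrank_le_one 0 fun g => ⟨0, by rw [h0 g, smul_zero]⟩

/-- The operator is a root of `X^N - 1`, `N = ∏ λ_i`, which is separable because `N ≠ 0` in `R`. -/
theorem isSemisimple_funLeft (p : ℕ) [CharP R p] (hlam : ∀ x, (σ ^ lam (c x)) x = x)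
    (hp : ∀ i, ¬ p ∣ lam i) : End.IsSemisimple (LinearMap.funLeft R R σ) := by
  have hN : ((∏ i, lam i : ℕ) : R) ≠ 0 := by
    rw [Nat.cast_prod]
    exact Finset.prod_ne_zero_iff.2 fun i _ => mt (CharP.cast_eq_zero_iff R p _).1 (hp i)
  refine End.isSemisimple_of_squarefree_aeval_eq_zero
    (Polynomial.X_pow_sub_one_separable_iff.2 hN).squarefree ?_
  have hT (k : ℕ) : (LinearMap.funLeft R R σ : End R (Fin n → R)) ^ k =
      LinearMap.funLeft R R (σ ^ k : Equiv.Perm (Fin n)) := by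
    induction k with
    | zero => rfl
    | succ k ih => rw [pow_succ, ih, pow_succ']; rfl
  have hσ : σ ^ (∏ i, lam i) = 1 := by
    ext1 x
    obtain ⟨k, hk⟩ := Finset.dvd_prod_of_mem lam (Finset.mem_univ (c x))
    rw [hk, pow_mul]
    exact Equiv.Perm.pow_apply_eq_self_of_apply_eq_self (hlam x) k
  rw [map_sub, map_pow, Polynomial.aeval_X, map_one, hT, hσ, sub_eq_zero]
  rfl

end Eigenspaces

/-- The fibre over `a` of the projection of a dependent sum. -/
def sigmaFstEqEquiv {α : Type*} {β : α → Type*} (a : α) : {x : Sigma β // x.1 = a} ≃ β a where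
  toFun x := x.2 ▸ x.1.2
  invFun b := ⟨⟨a, b⟩, rfl⟩
  left_inv := by
    rintro ⟨⟨_, b⟩, rfl⟩
    rfl
  right_inv _ := rfl

/-! ### Centralizers of diagonal matrices. -/

section Diagonal

variable {R : Type*} [Field R] {ι : Type*} [Fintype ι] [DecidableEq ι]

/-- The block diagonal embedding of a full matrix algebra and a diagonal algebra. -/
def blockDiagHom (R : Type*) [Field R] (I J : Type*) [Fintype I] [Fintype J] [DecidableEq I]
    [DecidableEq J] : Matrix I I R × (J → R) →ₐ[R] Matrix (I ⊕ J) (I ⊕ J) R where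
  toFun x := Matrix.fromBlocks x.1 0 0 (Matrix.diagonal x.2)
  map_one' := by simp
  map_mul' x y := by simp [Matrix.fromBlocks_multiply]
  map_zero' := by simp
  map_add' x y := by simp [Matrix.fromBlocks_add]
  commutes' r := by
    ext (i | i) (j | j) <;>
    simp [Matrix.algebraMap_matrix_apply, Matrix.diagonal_apply]

theorem blockDiagHom_injective (I J : Type*) [Fintype I] [Fintype J] [DecidableEq I]
    [DecidableEq J] : Function.Injective (blockDiagHom R I J) := by
  intro x y h
  obtain ⟨h1, -, -, h2⟩ := Matrix.fromBlocks_inj.1 h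
  exact Prod.ext h1 (Matrix.diagonal_injective h2)

/-- The commutator has entries `(d j - d i) * M i j`. -/
theorem commute_diagonal_iff {d : ι → R} {M : Matrix ι ι R} :
    Commute M (Matrix.diagonal d) ↔ ∀ i j, d i ≠ d j → M i j = 0 := by
  rw [Commute, SemiconjBy, ← Matrix.ext_iff]
  refine forall₂_congr fun i j => ?_
  rw [Matrix.mul_diagonal, Matrix.diagonal_mul, mul_comm, ← sub_eq_zero, ← sub_mul, mul_eq_zero,
    sub_eq_zero, or_iff_not_imp_left, ne_comm]

/-- Matrices commuting with a diagonal matrix, all of whose entries other than `1` are distinct,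
form the product of a full matrix algebra and a diagonal algebra. -/
theorem exists_algHom_range_eq_commute_diagonal (d : ι → R)
    (hd : ∀ i j, d i ≠ 1 → d i = d j → i = j) {s k : ℕ}
    (hs : Nat.card {i // d i = (1 : R)} = s) (hk : s + k = Fintype.card ι) :
    ∃ φ : Matrix (Fin s) (Fin s) R × (Fin k → R) →ₐ[R] Matrix ι ι R,
      Function.Injective φ ∧ ∀ M, M ∈ φ.range ↔ Commute M (Matrix.diagonal d) := by
  classical
  have hk' : Nat.card {i // ¬ d i = (1 : R)} = k := by
    rw [Nat.card_eq_fintype_card] at hs ⊢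
    rw [Fintype.card_subtype_compl, hs, ← hk, Nat.add_sub_cancel_left]
  let e : Fin s ⊕ Fin k ≃ ι := (Equiv.sumCongr (Finite.equivFinOfCardEq hs).symm
    (Finite.equivFinOfCardEq hk').symm).trans (Equiv.sumCompl _)
  have he₁ (i : Fin s) : d (e (Sum.inl i)) = 1 := ((Finite.equivFinOfCardEq hs).symm i).2
  have he₂ (j : Fin k) : d (e (Sum.inr j)) ≠ 1 := ((Finite.equivFinOfCardEq hk').symm j).2
  refine ⟨(Matrix.reindexAlgEquiv R R e).toAlgHom.comp (blockDiagHom R (Fin s) (Fin k)),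
    (Matrix.reindexAlgEquiv R R e).injective.comp (blockDiagHom_injective _ _), fun M => ?_⟩
  rw [commute_diagonal_iff]
  constructor
  · rintro ⟨x, rfl⟩ i j hij
    obtain ⟨i, rfl⟩ := e.surjective i
    obtain ⟨j, rfl⟩ := e.surjective j
    change Matrix.fromBlocks x.1 0 0 (Matrix.diagonal x.2) (e.symm (e i)) (e.symm (e j)) = 0
    rw [e.symm_apply_apply, e.symm_apply_apply]
    rcases i with i | i <;> rcases j with j | j
    · exact absurd ((he₁ i).trans (he₁ j).symm) hij
    · rfl
    · rfl
    · exact Matrix.diagonal_apply_ne _ fun h => hij (by rw [h])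
  · intro hM
    refine ⟨(fun i j => M (e (Sum.inl i)) (e (Sum.inl j)),
      fun i => M (e (Sum.inr i)) (e (Sum.inr i))), ?_⟩
    ext i j
    obtain ⟨i, rfl⟩ := e.surjective i
    obtain ⟨j, rfl⟩ := e.surjective j
    change Matrix.fromBlocks _ 0 0 (Matrix.diagonal _) (e.symm (e i)) (e.symm (e j)) = _
    rw [e.symm_apply_apply, e.symm_apply_apply]
    rcases i with i | i <;> rcases j with j | j
    · rfl
    · exact (hM _ _ (by rw [he₁]; exact (he₂ j).symm)).symm
    · exact (hM _ _ (by rw [he₁]; exact he₂ i)).symm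
    · change Matrix.diagonal _ i j = _
      by_cases hij : i = j
      · rw [hij, Matrix.diagonal_apply_eq]
      · rw [Matrix.diagonal_apply_ne _ hij]
        refine (hM _ _ fun h => hij ?_).symm
        exact Sum.inr_injective (e.injective (hd _ _ (he₂ i) h))

end Diagonal

/-! ### Block structure of the invariant matrix algebra. -/

section Structure

variable {R : Type*} [Field R] {n : ℕ} {σ : Equiv.Perm (Fin n)}

theorem mem_invariantMatrixAlgebra_iff {a : Matrix (Fin n) (Fin n) R} :
    a ∈ invariantMatrixAlgebra σ R ↔
      Commute (Matrix.toLin' a : End R (Fin n → R)) (LinearMap.funLeft R R σ) := by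
  have hT : (LinearMap.funLeft R R σ : (Fin n → R) →ₗ[R] (Fin n → R)) =
      Matrix.toLin' (σ.toPEquiv.toMatrix : Matrix (Fin n) (Fin n) R) := by
    refine LinearMap.ext fun f => ?_
    rw [Matrix.toLin'_apply, PEquiv.toMatrix_toPEquiv_mulVec]
    rfl
  rw [hT, Commute, SemiconjBy, Module.End.mul_eq_comp, Module.End.mul_eq_comp,
    ← Matrix.toLin'_mul, ← Matrix.toLin'_mul, Matrix.toLin'.injective.eq_iff,
    PEquiv.toMatrix_toPEquiv_mul, PEquiv.mul_toMatrix_toPEquiv, ← Matrix.ext_iff]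
  change (∀ i j, a i j = a (σ i) (σ j)) ↔ ∀ i j, a i (σ.symm j) = a (σ i) j
  refine forall_congr' fun i => ⟨fun h j => ?_, fun h j => ?_⟩
  · rw [h, σ.apply_symm_apply]
  · rw [← h, σ.symm_apply_apply]

/-- The structure of the invariant matrix algebra: one matrix block for the eigenvalue `1`, and
one-dimensional blocks for the other eigenvalues of the permutation. -/
theorem nonempty_invariantMatrixAlgebra_algEquiv [IsAlgClosed R] (p : ℕ) [CharP R p] {s : ℕ}
    {lam : Fin s → ℕ} (h : HasFullCycleType σ lam) (hp : ∀ i, ¬ p ∣ lam i)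
    (hcop : Pairwise fun i j => Nat.Coprime (lam i) (lam j)) :
    ∃ k, s + k = n ∧ Nonempty
      (invariantMatrixAlgebra σ R ≃ₐ[R] Matrix (Fin s) (Fin s) R × (Fin k → R)) := by
  classical
  obtain ⟨c, hc, hσ, hlam⟩ := h.exists_labelling
  let T : End R (Fin n → R) := LinearMap.funLeft R R σ
  have hT : DirectSum.IsInternal T.eigenspace :=
    (DirectSum.isInternal_submodule_iff_iSupIndep_and_iSup_eq_top _).2
      ⟨T.eigenspaces_iSupIndep, (isSemisimple_funLeft p hlam hp).iSup_eigenspace_eq_top⟩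
  let b := hT.collectedBasis fun μ => finBasis R (T.eigenspace μ)
  -- The index runs over all `μ` in `R`, but is finite since it indexes a basis of `R^n`.
  let _ : Fintype (Σ μ : R, Fin (finrank R (T.eigenspace μ))) := FiniteDimensional.fintypeBasisIndex b
  let d : (Σ μ : R, Fin (finrank R (T.eigenspace μ))) → R := Sigma.fst
  have hb (i) : T (b i) = d i • b i := End.mem_eigenspace_iff.1 (hT.collectedBasis_mem _ i)
  have hd : ∀ i j, d i ≠ 1 → d i = d j → i = j := by
    rintro ⟨μ, i⟩ ⟨ν, j⟩ hμ hμν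
    change μ = ν at hμν
    subst hμν
    have := Fin.subsingleton_iff_le_one.2 (finrank_eigenspace_le_one hσ hlam hcop hμ)
    rw [Subsingleton.elim i j]
  have hs : Nat.card {i // d i = (1 : R)} = s := by
    refine (Nat.card_congr (sigmaFstEqEquiv (1 : R))).trans ?_
    rw [Nat.card_fin]
    exact finrank_eigenspace_one hc hσ
  have hcard : Fintype.card (Σ μ : R, Fin (finrank R (T.eigenspace μ))) = n := by
    rw [← finrank_eq_card_basis b, finrank_fin_fun]
  obtain ⟨k, hk⟩ : ∃ k, s + k = Fintype.card (Σ μ : R, Fin (finrank R (T.eigenspace μ))) :=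
    ⟨_, Nat.add_sub_cancel' (by rw [← hs, Nat.card_eq_fintype_card]; exact Fintype.card_subtype_le _)⟩
  refine ⟨k, hk.trans hcard, ?_⟩
  obtain ⟨φ, hφ, hrange⟩ := exists_algHom_range_eq_commute_diagonal d hd hs hk
  have hdiag : Matrix.toLinAlgEquiv b (Matrix.diagonal d) = T := by
    refine b.ext fun i => ?_
    rw [Matrix.toLinAlgEquiv_self, hb, Finset.sum_eq_single i]
    · rw [Matrix.diagonal_apply_eq]
    · intro j _ hj
      rw [Matrix.diagonal_apply_ne _ hj, zero_smul]
    · simp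
  -- Change of basis from the eigenbasis to the standard one; it carries the centralizer of
  -- `diagonal d` to that of `T`.
  let Φ : Matrix _ _ R ≃ₐ[R] Matrix (Fin n) (Fin n) R :=
    (Matrix.toLinAlgEquiv b).trans LinearMap.toMatrixAlgEquiv'
  have hΦ (M) : Matrix.toLin' (Φ M) = Matrix.toLinAlgEquiv b M := by
    change Matrix.toLin' (LinearMap.toMatrix' (Matrix.toLinAlgEquiv b M)) = _
    rw [Matrix.toLin'_toMatrix']
  have hmem : (Φ.toAlgHom.comp φ).range = invariantMatrixAlgebra σ R := by
    ext a
    obtain ⟨M, rfl⟩ := Φ.surjective a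
    rw [mem_invariantMatrixAlgebra_iff, hΦ]
    have hcomm := commute_map_iff (Matrix.toLinAlgEquiv b).injective (x := M) (y := .diagonal d)
    rw [hdiag] at hcomm
    refine Iff.trans ?_ ((hrange M).trans hcomm.symm)
    refine exists_congr fun x => ?_
    exact Φ.injective.eq_iff
  exact ⟨((AlgEquiv.ofInjective _ (Φ.injective.comp hφ)).trans
    (Subalgebra.equivOfEq _ _ hmem)).symm⟩

end Structure

/-! ### Classification of the block algebras and the conclusion. -/

theorem finrank_block (R : Type*) [Field R] (s k : ℕ) :
    finrank R (Matrix (Fin s) (Fin s) R × (Fin k → R)) = s * s + k := by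
  rw [finrank_prod, finrank_matrix, finrank_fin_fun, finrank_self, Fintype.card_fin, mul_one]

theorem isMoritaEquivalent_block (R : Type*) [Field R] {s : ℕ} (hs : 0 < s) (k : ℕ) :
    IsMoritaEquivalent R (Matrix (Fin s) (Fin s) R × (Fin k → R)) (R × (Fin k → R)) := by
  have : Nonempty (Fin s) := ⟨⟨0, hs⟩⟩
  exact ((IsMoritaEquivalent.matrix R (ι := Fin s) R).prod_right (Fin k → R)).symm

theorem isMoritaEquivalent_block_iff (R : Type*) [Field R] {s t : ℕ} (hs : 0 < s) (ht : 0 < t)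
    (k l : ℕ) :
    IsMoritaEquivalent R (Matrix (Fin s) (Fin s) R × (Fin k → R))
      (Matrix (Fin t) (Fin t) R × (Fin l → R)) ↔ k = l := by
  constructor
  · intro h
    have h' := ((isMoritaEquivalent_block R hs k).symm.trans R h).trans R
      (isMoritaEquivalent_block R ht l)
    have h1 := finrank_le_of_isMoritaEquivalent h'
    have h2 := finrank_le_of_isMoritaEquivalent h'.symm
    rw [finrank_prod, finrank_prod, finrank_fin_fun, finrank_fin_fun] at h1 h2
    omega
  · rintro rfl
    exact (isMoritaEquivalent_block R hs k).trans R (isMoritaEquivalent_block R ht k).symm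

/-- Ensures a nonzero matrix block, as its Morita equivalence with `R` requires. -/
theorem HasFullCycleType.pos {n s : ℕ} {σ : Equiv.Perm (Fin n)} {lam : Fin s → ℕ}
    (h : HasFullCycleType σ lam) (hn : 0 < n) : 0 < s := by
  obtain ⟨c, -⟩ := h.exists_labelling
  exact Fin.pos (c ⟨0, hn⟩)

theorem corollary3p14 {R : Type*} [Field R] [IsAlgClosed R] (p : ℕ) [CharP R p]
    {n m s t : ℕ} (hn : 0 < n) (hm : 0 < m)
    (σ : Equiv.Perm (Fin n)) (τ : Equiv.Perm (Fin m))
    (lam : Fin s → ℕ) (mu : Fin t → ℕ)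
    (hσ : HasFullCycleType σ lam) (hτ : HasFullCycleType τ mu)
    (hplam : ∀ i, ¬ p ∣ lam i) (hpmu : ∀ j, ¬ p ∣ mu j)
    (hlam : Pairwise fun i j => Nat.Coprime (lam i) (lam j))
    (hmu : Pairwise fun i j => Nat.Coprime (mu i) (mu j)) :
    (Nonempty (invariantMatrixAlgebra σ R ≃ₐ[R] invariantMatrixAlgebra τ R) ↔
        n = m ∧ s = t) ∧
      (IsMoritaEquivalent R (invariantMatrixAlgebra σ R) (invariantMatrixAlgebra τ R) ↔
        (n : ℤ) - s = (m : ℤ) - t) := by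
  obtain ⟨k, hk, ⟨e⟩⟩ := nonempty_invariantMatrixAlgebra_algEquiv (R := R) p hσ hplam hlam
  obtain ⟨l, hl, ⟨f⟩⟩ := nonempty_invariantMatrixAlgebra_algEquiv (R := R) p hτ hpmu hmu
  have hmorita : IsMoritaEquivalent R (invariantMatrixAlgebra σ R) (invariantMatrixAlgebra τ R) ↔
      k = l := by
    rw [← isMoritaEquivalent_block_iff R (hσ.pos hn) (hτ.pos hm) k l]
    exact ⟨fun h => ((IsMoritaEquivalent.of_algEquiv R e.symm).trans R h).trans R (.of_algEquiv R f),
      fun h => ((IsMoritaEquivalent.of_algEquiv R e).trans R h).trans R (.of_algEquiv R f.symm)⟩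
  refine ⟨⟨?_, ?_⟩, hmorita.trans (by omega)⟩
  · rintro ⟨g⟩
    -- Dimension alone gives only `s² + k = t² + l`; part (2) supplies `k = l`.
    have hkl : k = l := hmorita.1 (.of_algEquiv R g)
    have h := ((e.symm.trans g).trans f).toLinearEquiv.finrank_eq
    rw [finrank_block, finrank_block, hkl, Nat.add_right_cancel_iff, Nat.mul_self_inj] at h
    omega
  · rintro ⟨hnm, rfl⟩
    obtain rfl : k = l := by omega
    exact ⟨e.trans f.symm⟩
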